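/- Binary strings are encoded as first-order structures over the vocabulary $\langle <, S\,;\,\mathsf{min},\mathsf{max}\rangle$ with equality, where $<$ is a binary relation symbol, $S$ a unary relation symbol, and $\mathsf{min},\mathsf{max}$ are constant symbols. For $n\ge 1$, a string $w=(w_1,\dots,w_n)\in\{0,1\}^n$ is encoded by the structure with universe $\{1,\dots,n\}$, in which $<$ is the usual order, $S=\{i : w_i=1\}$, $\mathsf{min}=1$ and $\mathsf{max}=n$. A first-order sentence $\varphi$ separates $(\mathcal A,\mathcal B)$ if it is true in (the structure of) every string of $\mathcal A$ and false in every string of $\mathcal B$. **Theorem.** For every $\varepsilon>0$ there is a constant $C_\varepsilon$ such that for every $n\ge 1$ and any two disjoint sets $\mathcal A,\mathcal B\subseteq\{0,1\}^n$ there is a first-order sentence that separates $(\mathcal A,\mathcal B)$ and contains at most $$(1+\varepsilon)\,\frac{n}{\log_2 n}+C_\varepsilon$$ occurrences of quantifiers. (For $n=1$, where $n/\log_2 n$ is undefined, the first term is read as $0$.) -/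

import Mathlib

open FirstOrder

namespace BinString

/-- Function symbols of the vocabulary of binary strings: the two constants `min` and `max`. -/
inductive Func : ℕ → Type
  | min : Func 0
  | max : Func 0

/-- Relation symbols of the vocabulary of binary strings: the binary `<` and the unary `S`. -/
inductive Rel : ℕ → Type
  | lt : Rel 2
  | S : Rel 1

/-- The vocabulary `⟨<, S ; min, max⟩` of binary strings. -/
def vocabulary : FirstOrder.Language.{0, 0} := ⟨Func, Rel⟩

/-- The structure encoding a string `w` of `n ≥ 1` bits. Its universe is the set of the `n`
positions, `<` is their usual order, `S` is the set of the positions that hold a `1`, and `min`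
and `max` are the first and the last position. -/
@[reducible] def toStructure {n : ℕ} [NeZero n] (w : Fin n → Bool) :
    vocabulary.Structure (Fin n) where
  funMap {_} f _ :=
    match f with
    | Func.min => 0
    | Func.max => Fin.rev 0
  RelMap {_} R xs :=
    match R, xs with
    | Rel.lt, xs => xs 0 < xs 1
    | Rel.S, xs => w (xs 0) = true

/-- The structure encoding `w` satisfies the sentence `φ`. -/
def Models {n : ℕ} [NeZero n] (w : Fin n → Bool) (φ : vocabulary.Sentence) : Prop :=
  letI := toStructure w
  Fin n ⊨ φ

/-- The sentence `φ` separates `A` from `B`: it holds in every string of `A` and fails in every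
string of `B`. -/
def Separates {n : ℕ} [NeZero n] (φ : vocabulary.Sentence) (A B : Set (Fin n → Bool)) : Prop :=
  (∀ w ∈ A, Models w φ) ∧ ∀ w ∈ B, ¬ Models w φ

/-- The number of occurrences of quantifiers in a first-order formula. The existential quantifier,
which is the abbreviation `∼ ∀' ∼`, counts as one; connectives other than `→` are abbreviations
that do not change the count of their parts. -/
def quantifierCount {L : FirstOrder.Language.{0, 0}} {α : Type} : {m : ℕ} → L.BoundedFormula α m → ℕ
  | _, .falsum => 0
  | _, .equal _ _ => 0
  | _, .rel _ _ => 0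
  | _, .imp φ ψ => quantifierCount φ + quantifierCount ψ
  | _, .all φ => quantifierCount φ + 1

end BinString

namespace BinString

open FirstOrder.Language

/-! The sentence is `∃ x₁ … x_m ∀ y₁ … y_l` over a quantifier-free matrix, whose size is free. The
information lies in the order of quantification: `m` evenly spread positions can be listed in `m!`
orders, so if `2 ^ n ≤ m!` each string `w` gets its own order, and the order type of the marks names
`w`. The universal block then checks the named string: the matrix says that `(x, y)` has the atomic
type of marks and some tuple in a string of `A`. As each cell between marks has fewer than `l`
elements, one tuple covers a whole cell, and the cellwise matchings glue to a strictly increasing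
self-map of `Fin n`, the identity (`eq_of_sameType_append`). Stirling allows `m ≈ (1 + ε/2) n / log₂
n`, and `l ≈ n / m` is of lower order. -/

/-- The predicate `P` on strings with `k` marked positions is defined by a formula with at most `c`
quantifiers. -/
def DefinableWithin {n : ℕ} [NeZero n] {k : ℕ} (c : ℕ)
    (P : (Fin n → Bool) → (Fin k → Fin n) → Prop) : Prop :=
  ∃ θ : vocabulary.BoundedFormula Empty k, quantifierCount θ ≤ c ∧
    ∀ w xs, @BoundedFormula.Realize vocabulary (Fin n) (toStructure w) Empty k θ default xs ↔ P w xs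

/-! ### Counting quantifiers in definable predicates -/

namespace DefinableWithin

variable {n : ℕ} [NeZero n] {k c d : ℕ} {P Q : (Fin n → Bool) → (Fin k → Fin n) → Prop}

theorem congr (h : DefinableWithin c P) (hPQ : ∀ w xs, P w xs ↔ Q w xs) : DefinableWithin c Q := by
  obtain ⟨θ, h1, h2⟩ := h
  exact ⟨θ, h1, fun w xs => (h2 w xs).trans (hPQ w xs)⟩

theorem false : DefinableWithin 0 (fun (_ : Fin n → Bool) (_ : Fin k → Fin n) => False) :=
  ⟨.falsum, le_rfl, fun _ _ => Iff.rfl⟩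

theorem imp (hP : DefinableWithin c P) (hQ : DefinableWithin d Q) :
    DefinableWithin (c + d) (fun w xs => P w xs → Q w xs) := by
  obtain ⟨θ, h1, h2⟩ := hP
  obtain ⟨η, h3, h4⟩ := hQ
  refine ⟨.imp θ η, Nat.add_le_add h1 h3, fun w xs => ?_⟩
  exact imp_congr (h2 w xs) (h4 w xs)

theorem not (hP : DefinableWithin c P) : DefinableWithin c (fun w xs => ¬ P w xs) :=
  hP.imp false

theorem and (hP : DefinableWithin c P) (hQ : DefinableWithin d Q) :
    DefinableWithin (c + d) (fun w xs => P w xs ∧ Q w xs) :=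
  (hP.imp hQ.not).not.congr fun w xs => by tauto

theorem lt (i j : Fin k) : DefinableWithin 0 (fun (_ : Fin n → Bool) xs => xs i < xs j) :=
  ⟨.rel (l := 2) Rel.lt ![.var (.inr i), .var (.inr j)], le_rfl, fun _ _ => Iff.rfl⟩

theorem bit (i : Fin k) : DefinableWithin 0 (fun (w : Fin n → Bool) xs => w (xs i) = true) :=
  ⟨.rel (l := 1) Rel.S ![.var (.inr i)], le_rfl, fun _ _ => Iff.rfl⟩

theorem iff_const (hP : DefinableWithin 0 P) (b : Prop) :
    DefinableWithin 0 (fun w xs => P w xs ↔ b) := by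
  by_cases hb : b
  · exact hP.congr fun w xs => by tauto
  · exact hP.not.congr fun w xs => by tauto

/-- Connectives cost nothing, so for fixed `n` arbitrarily large finite case distinctions are free.
-/
theorem forall_finite {ι : Type*} [Finite ι] {P : ι → (Fin n → Bool) → (Fin k → Fin n) → Prop}
    (h : ∀ i, DefinableWithin 0 (P i)) : DefinableWithin 0 (fun w xs => ∀ i, P i w xs) := by
  classical
  cases nonempty_fintype ι
  have key : ∀ s : Finset ι, DefinableWithin 0 (fun w xs => ∀ i ∈ s, P i w xs) := by
    intro s
    induction s using Finset.induction_on with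
    | empty => exact false.not.congr fun w xs => by simp
    | insert a s _ ih => exact ((h a).and ih).congr fun w xs => by simp
  exact (key Finset.univ).congr fun w xs => by simp

theorem exists_finite {ι : Type*} [Finite ι] {P : ι → (Fin n → Bool) → (Fin k → Fin n) → Prop}
    (h : ∀ i, DefinableWithin 0 (P i)) : DefinableWithin 0 (fun w xs => ∃ i, P i w xs) :=
  (forall_finite fun i => (h i).not).not.congr fun w xs => by simp

theorem all {P : (Fin n → Bool) → (Fin (k + 1) → Fin n) → Prop} (h : DefinableWithin c P) :
    DefinableWithin (c + 1) (fun w xs => ∀ a, P w (Fin.snoc xs a)) := by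
  obtain ⟨θ, h1, h2⟩ := h
  refine ⟨.all θ, Nat.add_le_add_right h1 1, fun w xs => ?_⟩
  simp_rw [← h2]
  exact Iff.rfl

theorem alls {l : ℕ} {P : (Fin n → Bool) → (Fin (k + l) → Fin n) → Prop}
    (h : DefinableWithin c P) :
    DefinableWithin (c + l) (fun w xs => ∀ y : Fin l → Fin n, P w (Fin.append xs y)) := by
  induction l generalizing c with
  | zero =>
    refine h.congr fun w xs => ?_
    rw [(Equiv.ofUnique (Fin 0 → Fin n) Unit).forall_congr_left]
    simp [Fin.append_right_nil]
  | succ l ih =>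
    rw [show c + (l + 1) = c + 1 + l by ring]
    refine (ih h.all).congr fun w xs => ?_
    refine ⟨fun H y => ?_, fun H y a => ?_⟩
    · have := H (Fin.init y) (y (Fin.last l))
      rwa [← Fin.append_snoc, Fin.snoc_init_self] at this
    · rw [← Fin.append_snoc]
      exact H _

theorem exs {l : ℕ} {P : (Fin n → Bool) → (Fin (k + l) → Fin n) → Prop}
    (h : DefinableWithin c P) :
    DefinableWithin (c + l) (fun w xs => ∃ y : Fin l → Fin n, P w (Fin.append xs y)) :=
  h.not.alls.not.congr fun w xs => by simp

end DefinableWithin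

/-! ### Recovering a string from its marks -/

/-- Two strings with marked positions satisfy the same atomic formulas built from `<` and `S`. -/
def SameType {n k : ℕ} (w : Fin n → Bool) (x : Fin k → Fin n) (v : Fin n → Bool)
    (y : Fin k → Fin n) : Prop :=
  (∀ i j, x i < x j ↔ y i < y j) ∧ ∀ i, w (x i) = true ↔ v (y i) = true

theorem definableWithin_sameType {n k : ℕ} [NeZero n] (v : Fin n → Bool) (y : Fin k → Fin n) :
    DefinableWithin 0 (fun w x => SameType w x v y) :=
  (DefinableWithin.forall_finite fun i => DefinableWithin.forall_finite fun j =>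
    (DefinableWithin.lt i j).iff_const _).and
  (DefinableWithin.forall_finite fun i => (DefinableWithin.bit i).iff_const _)

/-- If every cell cut out by the marks `r` has fewer than `l` elements, and every `l` positions in
`(v, x)` look like some `l` positions in `(w, r)`, then `v = w`. -/
theorem eq_of_sameType_append {n m l : ℕ} [NeZero n] {w v : Fin n → Bool} {r x : Fin m → Fin n}
    (hgap : ∀ y : Fin l → Fin n, (∀ j k i, y j < r i ↔ y k < r i) → ¬ Function.Injective y)
    (h : ∀ y : Fin l → Fin n, ∃ z, SameType v (Fin.append x y) w (Fin.append r z)) : v = w := by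
  classical
  choose z hz using h
  have hyy (y : Fin l → Fin n) (j k) : y j < y k ↔ z y j < z y k := by
    simpa using (hz y).1 (Fin.natAdd m j) (Fin.natAdd m k)
  have hyx (y : Fin l → Fin n) (j i) : y j < x i ↔ z y j < r i := by
    simpa using (hz y).1 (Fin.natAdd m j) (Fin.castAdd l i)
  have hbit (y : Fin l → Fin n) (j) : v (y j) = w (z y j) := by
    simpa [← Bool.eq_iff_iff] using (hz y).2 (Fin.natAdd m j)
  have hinj (y : Fin l → Fin n) (hy : Function.Injective y) : Function.Injective (z y) := by
    intro j k hjk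
    refine hy (le_antisymm ?_ ?_) <;> rw [← not_lt, hyy, hjk] <;> exact lt_irrefl _
  let cell (q : Fin n) : Finset (Fin n) := {a | ∀ i, a < x i ↔ q < x i}
  -- Otherwise `l` distinct elements of a cell of `(v, x)` would be matched with `l` distinct
  -- elements of one cell of `(w, r)`.
  have hcard (q : Fin n) : (cell q).card ≤ l := by
    by_contra! hlt
    obtain ⟨f⟩ : Nonempty (Fin l ↪ cell q) :=
      Function.Embedding.nonempty_of_card_le (by simpa using hlt.le)
    have hf (j : Fin l) (i) : (f j : Fin n) < x i ↔ q < x i :=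
      (Finset.mem_filter.1 (f j).2).2 i
    refine hgap (z fun j => f j) (fun j k i => ?_)
      (hinj _ (Subtype.val_injective.comp f.injective))
    rw [← hyx, ← hyx, hf, hf]
  have henum (s : Finset (Fin n)) (hs : s.card ≤ l) (hne : s.Nonempty) :
      ∃ y : Fin l → Fin n, ∀ q ∈ s, ∃ j, y j = q := by
    obtain ⟨f⟩ : Nonempty (s ↪ Fin l) :=
      Function.Embedding.nonempty_of_card_le (by simpa using hs)
    have : Nonempty s := hne.to_subtype
    refine ⟨fun j => (Function.invFun f j : s), fun q hq => ⟨f ⟨q, hq⟩, ?_⟩⟩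
    exact congrArg Subtype.val (Function.leftInverse_invFun f.injective ⟨q, hq⟩)
  have hself (q : Fin n) : q ∈ cell q := by simp [cell]
  choose! e he using henum
  have heq {a b : Fin n} (hab : ∀ i, a < x i ↔ b < x i) : cell a = cell b := by
    simp only [cell, hab]
  have hidx (q : Fin n) : ∃ j, e (cell q) j = q := he _ (hcard q) ⟨q, hself q⟩ q (hself q)
  choose idx hidx using hidx
  -- One tuple serves a whole cell, so `Φ` is increasing inside cells; comparison with the marks
  -- makes it increasing across them.
  let Φ (q : Fin n) : Fin n := z (e (cell q)) (idx q)
  have hΦx (q : Fin n) (i) : q < x i ↔ Φ q < r i := by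
    rw [← hyx, hidx]
  have hmono : StrictMono Φ := by
    intro a b hab
    by_cases hc : ∀ i, a < x i ↔ b < x i
    · have hb := hidx b
      change z (e (cell a)) (idx a) < z (e (cell b)) (idx b)
      rw [← heq hc] at hb ⊢
      rw [← hyy, hidx, hb]
      exact hab
    · push Not at hc
      obtain ⟨i, ⟨h1, h2⟩ | ⟨h1, h2⟩⟩ := hc
      · exact ((hΦx a i).1 h1).trans_le (not_lt.1 fun h => not_lt.2 h2 ((hΦx b i).2 h))
      · exact absurd (hab.trans h2) (not_lt.2 h1)
  funext q
  have := hbit (e (cell q)) (idx q)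
  rw [hidx] at this
  rw [this]
  exact congrArg w (congrFun hmono.eq_id q)

/-- If every string `w` comes with marks `ref w` whose type identifies `w` and whose cells have
fewer than `l` elements, then every set of strings is defined with `m + l` quantifiers. -/
theorem exists_sentence_of_marks {n m l : ℕ} [NeZero n] (ref : (Fin n → Bool) → Fin m → Fin n)
    (hinj : ∀ w v, SameType w (ref w) v (ref v) → w = v)
    (hgap : ∀ w, ∀ y : Fin l → Fin n, (∀ j k i, y j < ref w i ↔ y k < ref w i) →
      ¬ Function.Injective y) (A : Set (Fin n → Bool)) :
    ∃ φ : vocabulary.Sentence, quantifierCount φ ≤ m + l ∧ ∀ w, Models w φ ↔ w ∈ A := by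
  have hdef : DefinableWithin (k := 0 + m + l) 0 (fun (v : Fin n → Bool) x =>
      -- The disjunct is chosen after `y`, so the string `p.1` might vary with `y`; `hsame` below
      -- excludes this, since the marks alone determine it.
      ∃ p : A × (Fin l → Fin n),
        SameType v x p.1 (Fin.append (Fin.append default (ref p.1)) p.2)) :=
    DefinableWithin.exists_finite fun p => definableWithin_sameType _ _
  obtain ⟨φ, h1, h2⟩ := hdef.alls.exs
  refine ⟨φ, by omega, fun v => ?_⟩
  have hmodels : Models v φ ↔ @BoundedFormula.Realize vocabulary (Fin n) (toStructure v) Empty 0 φ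
      default default := by
    unfold Models Sentence.Realize Formula.Realize
    congr!
  refine hmodels.trans <| (h2 v default).trans ⟨?_, fun hv => ⟨ref v, fun y => ⟨(⟨v, hv⟩, y), ?_⟩⟩⟩
  · rintro ⟨x, hx⟩
    choose p hp using hx
    have hpx (y : Fin l → Fin n) : SameType v x (p y).1 (ref (p y).1) := by
      constructor
      · intro i j
        simpa only [Fin.append_left, Fin.append_right] using
          (hp y).1 (Fin.castAdd l (Fin.natAdd 0 i)) (Fin.castAdd l (Fin.natAdd 0 j))
      · intro i
        simpa only [Fin.append_left, Fin.append_right] using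
          (hp y).2 (Fin.castAdd l (Fin.natAdd 0 i))
    have hsame (y u : Fin l → Fin n) : ((p y).1 : Fin n → Bool) = (p u).1 :=
      hinj _ _ ⟨fun i j => ((hpx y).1 i j).symm.trans ((hpx u).1 i j),
        fun i => ((hpx y).2 i).symm.trans ((hpx u).2 i)⟩
    let y₀ : Fin l → Fin n := fun _ => 0
    suffices v = (p y₀).1 from this ▸ (p y₀).1.2
    refine eq_of_sameType_append (m := 0 + m) (l := l) (x := Fin.append default x)
      (r := Fin.append default (ref (p y₀).1)) (fun y hy => ?_) fun y => ⟨(p y).2, ?_⟩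
    · refine hgap (p y₀).1 y fun j k i => ?_
      simpa only [Fin.append_right] using hy j k (Fin.natAdd 0 i)
    · have := hp y
      rwa [hsame y y₀] at this
  · exact ⟨fun _ _ => Iff.rfl, fun _ => Iff.rfl⟩

/-! ### Evenly spread marks -/

/-- The marks `⌊i n / m⌋` cut `Fin n` into cells of at most `n / m + 2` elements. -/
theorem exists_mark_between {n m a b : ℕ} (hm : 0 < m) (hb : b < n) (hab : a + n / m + 2 ≤ b) :
    ∃ i < m, a < i * n / m ∧ i * n / m ≤ b := by
  have hn : 0 < n := by omega
  have h1 : n < m * (n / m) + m := Nat.lt_mul_div_succ n hm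
  obtain ⟨i, hi1, hi2⟩ : ∃ i, (a + 1) * m ≤ i * n ∧ i * n < (a + 1) * m + n := by
    -- The ceiling of `(a + 1) m / n`: the first mark beyond `a`.
    refine ⟨((a + 1) * m + n - 1) / n, ?_, ?_⟩
    · have := Nat.lt_mul_div_succ ((a + 1) * m + n - 1) hn
      rw [mul_add, mul_one, mul_comm n] at this
      omega
    · have := Nat.div_mul_le_self ((a + 1) * m + n - 1) n
      omega
  have h2 : (a + n / m + 2) * m ≤ b * m := Nat.mul_le_mul_right m hab
  have h3 : (b + 1) * m ≤ n * m := Nat.mul_le_mul_right m hb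
  have h4 : i * n < b * m := by nlinarith
  refine ⟨i, ?_, (Nat.le_div_iff_mul_le hm).2 hi1, ?_⟩
  · refine lt_of_mul_lt_mul_right (a := n) ?_ (Nat.zero_le n)
    nlinarith
  · exact ((Nat.div_lt_iff_lt_mul hm).2 h4).le

/-- A string is encoded by the order in which `m` evenly spread marks are quantified, so
`m` marks are enough when `2 ^ n ≤ m!`. -/
theorem exists_sentence_of_two_pow_le_factorial {n m : ℕ} [NeZero n] (hm : 0 < m) (hmn : m ≤ n)
    (hfac : 2 ^ n ≤ m.factorial) (A : Set (Fin n → Bool)) :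
    ∃ φ : vocabulary.Sentence, quantifierCount φ ≤ m + (n / m + 3) ∧
      ∀ w, Models w φ ↔ w ∈ A := by
  have hn : 0 < n := hm.trans_le hmn
  obtain ⟨π⟩ : Nonempty ((Fin n → Bool) ↪ Equiv.Perm (Fin m)) :=
    Function.Embedding.nonempty_of_card_le (by simpa [Fintype.card_perm] using hfac)
  let p (i : Fin m) : Fin n := ⟨i * n / m, by
    rw [Nat.div_lt_iff_lt_mul hm, mul_comm]
    exact Nat.mul_lt_mul_of_pos_left i.2 hn⟩
  have hp : StrictMono p := by
    intro i j hij
    change (i : ℕ) * n / m < j * n / m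
    have h1 : ((i : ℕ) + 1) * n ≤ j * n := Nat.mul_le_mul_right n hij
    have h2 := Nat.div_mul_le_self ((i : ℕ) * n) m
    refine (Nat.le_div_iff_mul_le hm).2 ?_
    nlinarith
  refine exists_sentence_of_marks (fun w i => p (π w i)) (fun w v h => π.injective ?_)
    (fun w y hy hinj => ?_) A
  · have hmono : StrictMono fun i => π v ((π w).symm i) := by
      intro i j hij
      have := (h.1 ((π w).symm i) ((π w).symm j)).1
      simp only [Equiv.apply_symm_apply, hp.lt_iff_lt] at this
      exact this hij
    ext i
    simpa using congrArg Fin.val (congrFun hmono.eq_id (π w i)).symm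
  · have key (j k) : (y k : ℕ) < y j + n / m + 2 := by
      by_contra! hjk
      obtain ⟨i, hi, h1, h2⟩ := exists_mark_between hm (y k).2 hjk
      have := hy j k ((π w).symm ⟨i, hi⟩)
      simp only [Equiv.apply_symm_apply] at this
      exact absurd (this.1 (Fin.lt_def.2 h1)) (not_lt.2 (Fin.le_def.2 h2))
    obtain ⟨j₀, -, hj₀⟩ := Finset.exists_min_image Finset.univ y ⟨0, Finset.mem_univ _⟩
    have hcard : (Finset.univ.image fun j => (y j : ℕ)).card = n / m + 3 := by
      exact (Finset.card_image_of_injective _ (Fin.val_injective.comp hinj)).trans (by simp)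
    have hsub : (Finset.univ.image fun j => (y j : ℕ)) ⊆
        Finset.Ico (y j₀ : ℕ) (y j₀ + n / m + 2) := by
      intro q hq
      obtain ⟨j, -, rfl⟩ := Finset.mem_image.1 hq
      exact Finset.mem_Ico.2 ⟨hj₀ j (Finset.mem_univ j), key j₀ j⟩
    have := Finset.card_le_card hsub
    rw [hcard, Nat.card_Ico] at this
    generalize n / m = t at this
    omega

/-- Marking every position lets the bits name the string, and `n + 1` positions are never distinct.
This serves the small `n`. -/
theorem exists_sentence_of_length {n : ℕ} [NeZero n] (A : Set (Fin n → Bool)) :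
    ∃ φ : vocabulary.Sentence, quantifierCount φ ≤ n + (n + 1) ∧ ∀ w, Models w φ ↔ w ∈ A := by
  refine exists_sentence_of_marks (fun _ => id) (fun w v h => ?_) (fun w y _ hinj => ?_) A
  · funext i
    exact Bool.eq_iff_iff.2 (h.2 i)
  · simpa using Fintype.card_le_of_injective y hinj

/-! ### Asymptotics of the number of marks -/

open Filter in
/-- For all large `n`, about `(1 + ε / 2) n / log₂ n` marks have at least `2 ^ n` orderings. -/
theorem eventually_exists_factorial_bound {ε : ℝ} (hε : 0 < ε) :
    ∀ᶠ n : ℕ in atTop, ∃ m : ℕ, 0 < m ∧ m ≤ n ∧ 2 ^ n ≤ m.factorial ∧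
      ((m + (n / m + 3) : ℕ) : ℝ) ≤ (1 + ε) * ((n : ℝ) / Real.logb 2 n) := by
  have hlog : Tendsto (fun n : ℕ => Real.log n) atTop atTop :=
    Real.tendsto_log_atTop.comp tendsto_natCast_atTop_atTop
  have hl2 : 0 < Real.log 2 := Real.log_pos one_lt_two
  have hδ : 0 < ε / (2 * (2 + ε)) := by positivity
  have e1 : ∀ᶠ n : ℕ in atTop, Real.log (Real.log n) ≤ ε / (2 * (2 + ε)) * Real.log n := by
    have := (Real.isLittleO_log_id_atTop.comp_tendsto hlog).bound hδ
    filter_upwards [this, hlog.eventually_ge_atTop 1] with n h1 h2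
    simp only [Function.comp, id, Real.norm_eq_abs] at h1
    rw [abs_of_nonneg (by linarith : 0 ≤ Real.log n)] at h1
    exact (le_abs_self _).trans h1
  have e2 : ∀ᶠ n : ℕ in atTop, Real.log n ^ 2 ≤ ε * Real.log 2 ^ 2 / 16 * n := by
    have := ((Real.isLittleO_pow_log_id_atTop (n := 2)).comp_tendsto
      (tendsto_natCast_atTop_atTop (R := ℝ))).bound (show 0 < ε * Real.log 2 ^ 2 / 16 by positivity)
    filter_upwards [this] with n h1
    simpa using h1
  filter_upwards [e1, e2, hlog.eventually_ge_atTop (1 + ε), hlog.eventually_ge_atTop 4,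
    hlog.eventually_ge_atTop (2 / (ε / (2 * (2 + ε)))), eventually_gt_atTop 0]
    with n h1 h2 h3 h4 h5 hn
  set b : ℝ := Real.log 2
  set l : ℝ := Real.log n
  set δ : ℝ := ε / (2 * (2 + ε)) with hδdef
  have hN : (0 : ℝ) < n := Nat.cast_pos.2 hn
  have hl0 : 0 < l := by linarith
  have hb1 : b ≤ 1 := by linarith [Real.log_two_lt_d9]
  have hb2 : 1 / 2 ≤ b := by linarith [Real.log_two_gt_d9]
  have hlogb : Real.logb 2 n = l / b := rfl
  -- `n * b / l` is `n / log₂ n`; the factor `1 + ε / 2` pays for the `log log n` lost in `log m`,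
  -- and the other `ε / 2` pays for the universal block.
  set X : ℝ := (1 + ε / 2) * (n * b / l) with hX
  have hX0 : 0 < X := by positivity
  have hXm : X ≤ (⌈X⌉₊ : ℝ) := Nat.le_ceil X
  have hmX : (⌈X⌉₊ : ℝ) < X + 1 := Nat.ceil_lt_add_one hX0.le
  have hm0 : 0 < ⌈X⌉₊ := Nat.ceil_pos.2 hX0
  have hdiv : ((n / ⌈X⌉₊ : ℕ) : ℝ) ≤ l / b := by
    calc ((n / ⌈X⌉₊ : ℕ) : ℝ) ≤ n / ⌈X⌉₊ := Nat.cast_div_le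
      _ ≤ n / (n * b / l) := by
        gcongr
        refine le_trans ?_ hXm
        have : 0 ≤ ε / 2 * (n * b / l) := by positivity
        linarith
      _ = l / b := by field_simp
  have htotal : ((⌈X⌉₊ + (n / ⌈X⌉₊ + 3) : ℕ) : ℝ) ≤ (1 + ε) * ((n : ℝ) / Real.logb 2 n) := by
    have hlb : l ≤ l / b := by
      rw [le_div_iff₀ hl2]
      nlinarith
    have hsq : 2 * (l / b) ≤ ε / 2 * (n * b / l) := by
      rw [← mul_div_assoc, ← mul_div_assoc, div_le_div_iff₀ hl2 hl0]
      nlinarith [show 0 ≤ ε * b ^ 2 * n by positivity]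
    have hfrac : (n : ℝ) / Real.logb 2 n = n * b / l := by
      rw [hlogb]
      field_simp
    rw [hfrac]
    push_cast
    linarith
  have hmn : ⌈X⌉₊ ≤ n := by
    have h6 : (1 + ε) * ((n : ℝ) / Real.logb 2 n) ≤ n := by
      rw [hlogb, ← mul_div_assoc, div_le_iff₀ (by positivity)]
      have : l ≤ l / b := by
        rw [le_div_iff₀ hl2]
        nlinarith
      nlinarith
    exact (Nat.le_add_right _ _).trans (Nat.cast_le.1 (htotal.trans h6))
  refine ⟨⌈X⌉₊, hm0, hmn, ?_, htotal⟩
  set m := ⌈X⌉₊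
  have hm : (0 : ℝ) < m := Nat.cast_pos.2 hm0
  have hlogX : Real.log X = Real.log (1 + ε / 2) + (l + Real.log b - Real.log l) := by
    rw [hX, Real.log_mul (by positivity) (by positivity), Real.log_div (by positivity) hl0.ne',
      Real.log_mul hN.ne' hl2.ne']
  have hlogm : l - Real.log l - 1 ≤ Real.log m := by
    have h6 : Real.log X ≤ Real.log m := Real.log_le_log hX0 hXm
    have h7 : 0 ≤ Real.log (1 + ε / 2) := Real.log_nonneg (by linarith)
    have h8 : 1 - b⁻¹ ≤ Real.log b := Real.one_sub_inv_le_log_of_pos hl2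
    have h9 : b⁻¹ ≤ 2 := by
      rw [inv_le_comm₀ hl2 two_pos]
      linarith
    linarith
  -- This identity dictates `δ`: one `δ * l` absorbs `log l`, the other the constant `2`.
  have hfrac : 1 / (1 + ε / 2) = 1 - 2 * δ := by
    rw [hδdef]
    field_simp
    ring
  have hexp : n * b ≤ m * (Real.log m - 1) := by
    have h6 : 2 ≤ δ * l := by
      rw [div_le_iff₀ hδ] at h5
      linarith
    have h7 : l * (1 / (1 + ε / 2)) ≤ Real.log m - 1 := by
      rw [hfrac]
      linarith
    calc n * b = X * (l * (1 / (1 + ε / 2))) := by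
          rw [hX]
          field_simp
      _ ≤ m * (Real.log m - 1) := by gcongr
  have hfac : (2 : ℝ) ^ n ≤ m.factorial := by
    -- The weak Stirling bound `m! ≥ (m / e) ^ m`.
    have h6 := Real.pow_div_factorial_le_exp (m : ℝ) hm.le m
    rw [div_le_iff₀ (by positivity)] at h6
    have h7 : (m : ℝ) ^ m = Real.exp (m * Real.log m) := by
      rw [mul_comm, Real.exp_mul, Real.exp_log hm, Real.rpow_natCast]
    have h8 : (2 : ℝ) ^ n = Real.exp (n * b) := by
      rw [mul_comm, Real.exp_mul, Real.exp_log two_pos, Real.rpow_natCast]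
    refine le_of_mul_le_mul_left ?_ (Real.exp_pos m)
    refine le_trans ?_ h6
    rw [h7, h8, ← Real.exp_add]
    exact Real.exp_le_exp.2 (by linarith)
  exact_mod_cast hfac

end BinString

theorem theorem5 :
    ∀ ε : ℝ, 0 < ε → ∃ C : ℝ, ∀ (n : ℕ) [NeZero n] (A B : Set (Fin n → Bool)), Disjoint A B →
      ∃ φ : BinString.vocabulary.Sentence,
        (BinString.quantifierCount φ : ℝ) ≤ (1 + ε) * ((n : ℝ) / Real.logb 2 (n : ℝ)) + C ∧
          BinString.Separates φ A B := by
  intro ε hε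
  obtain ⟨N, hN⟩ := Filter.eventually_atTop.1 (BinString.eventually_exists_factorial_bound hε)
  -- The constant pays for `n + (n + 1)` quantifiers when `n ≤ N`.
  refine ⟨2 * N + 1, fun n _ A B hAB => ?_⟩
  suffices ∃ φ : BinString.vocabulary.Sentence, (BinString.quantifierCount φ : ℝ) ≤
      (1 + ε) * ((n : ℝ) / Real.logb 2 (n : ℝ)) + (2 * N + 1) ∧
        ∀ w, BinString.Models w φ ↔ w ∈ A by
    obtain ⟨φ, h1, h2⟩ := this
    exact ⟨φ, h1, fun w hw => (h2 w).2 hw,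
      fun w hw h => Set.disjoint_left.1 hAB ((h2 w).1 h) hw⟩
  rcases le_total N n with h | h
  · obtain ⟨m, hm, hmn, hfac, hle⟩ := hN n h
    obtain ⟨φ, h1, h2⟩ := BinString.exists_sentence_of_two_pow_le_factorial hm hmn hfac A
    refine ⟨φ, ?_, h2⟩
    have : (BinString.quantifierCount φ : ℝ) ≤ (m + (n / m + 3) : ℕ) := Nat.cast_le.2 h1
    have : (0 : ℝ) ≤ N := Nat.cast_nonneg N
    linarith
  · obtain ⟨φ, h1, h2⟩ := BinString.exists_sentence_of_length A
    refine ⟨φ, ?_, h2⟩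
    have h3 : (BinString.quantifierCount φ : ℝ) ≤ (n + (n + 1) : ℕ) := Nat.cast_le.2 h1
    have h4 : (n : ℝ) ≤ N := Nat.cast_le.2 h
    have h5 : 0 ≤ Real.logb 2 (n : ℝ) :=
      Real.logb_nonneg one_lt_two (Nat.one_le_cast.2 (Nat.pos_of_neZero n))
    -- For `n = 1` the quotient is `1 / 0 = 0`, the stated convention.
    have h6 : 0 ≤ (1 + ε) * ((n : ℝ) / Real.logb 2 (n : ℝ)) := by positivity
    push_cast at h3
    linarith
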